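/- Let $d\ge 3$, $n=d/2$ and $R_1,R_2>0$. Let $f:[-R_1,R_2]\to[0,\infty)$ be continuous and concave, and let $$K_f=\{x\in\mathbb R^d:\ -R_1\le x_1\le R_2,\ x_2^2+\dots+x_d^2\le f(x_1)^2\}.$$ Let $0<\tau<\tfrac12$, let $h\in C^\infty(\mathbb R)$ vanish outside $[1-2\tau,1-\tau]$, and put $L(s,t)=st+h(s)$. Suppose that for every $s>0$ the line $t\mapsto L(s,t)$ meets the union of the graphs of $f$ and $-f$ over $[-R_1,R_2]$ at points with first coordinates $-x(s)<y(s)$, and that for all $s>0$ $$\int_{-x(s)}^{y(s)}\bigl(f(t)^2-L(s,t)^2\bigr)^{n}\,dt=\int_{-1/\sqrt{1+s^2}}^{1/\sqrt{1+s^2}}\bigl(1-t^2-s^2t^2\bigr)^{n}\,dt,$$ $$\int_{-x(s)}^{y(s)}\bigl(f(t)^2-L(s,t)^2\bigr)^{n-1}\,\frac{\partial L}{\partial s}(s,t)\,dt=0.$$ Then $K_f$ floats in equilibrium in every orientation at the level $\mathrm{vol}_d(K_f)/2$: for every unit vector $\xi\in\mathbb R^d$ there is $t\in\mathbb R$ such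 that $K_f\cap\{p:\ p\cdot\xi\le t\}$ has volume $\mathrm{vol}_d(K_f)/2$ and the line through the centers of mass of $K_f$ and of $K_f\cap\{p:\ p\cdot\xi\le t\}$ (which are distinct) is parallel to $\xi$. Moreover, the right-hand side of the first identity equals $c/\sqrt{1+s^2}$ for all $s>0$, with a constant $c>0$ independent of $s$. -/

import Mathlib

open scoped ContDiff

noncomputable section

/-- The center of mass of `A ⊆ ℝᵈ`, i.e. `(1 / vol A) ∫_A p dp`. -/
def centerOfMass {d : ℕ} (A : Set (EuclideanSpace ℝ (Fin d))) : EuclideanSpace ℝ (Fin d) :=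
  ⨍ p in A, p ∂MeasureTheory.volume

/-- The closed half-space `{p : p · ξ ≤ t}` bounded by the hyperplane `{p : p · ξ = t}`. -/
def lowerHalfSpace {d : ℕ} (ξ : EuclideanSpace ℝ (Fin d)) (t : ℝ) :
    Set (EuclideanSpace ℝ (Fin d)) :=
  {p | inner ℝ p ξ ≤ t}

/-- The hyperplane `{p : p · ξ = t}` is the cutting hyperplane of `K` in the direction `ξ`:
the submerged part `K ∩ {p : p · ξ ≤ t}` has volume `δ`. -/
def IsCuttingLevel {d : ℕ} (K : Set (EuclideanSpace ℝ (Fin d))) (δ : ENNReal)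
    (ξ : EuclideanSpace ℝ (Fin d)) (t : ℝ) : Prop :=
  MeasureTheory.volume (K ∩ lowerHalfSpace ξ t) = δ

/-- `K` floats in equilibrium in the direction `ξ` at the level `δ`: the line through the center
of mass of `K` and that of the submerged part of volume `δ` is parallel to `ξ`. (For a convex body
and `0 < δ < vol K` the number `t` is unique. If the two centers coincided there would be no such
line, and the equality below would fail for `ξ ≠ 0`.) -/
def FloatsInDirection {d : ℕ} (K : Set (EuclideanSpace ℝ (Fin d))) (δ : ENNReal)
    (ξ : EuclideanSpace ℝ (Fin d)) : Prop :=
  ∃ t : ℝ, IsCuttingLevel K δ ξ t ∧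
    (affineSpan ℝ {centerOfMass K, centerOfMass (K ∩ lowerHalfSpace ξ t)}).direction =
      Submodule.span ℝ {ξ}

/-- `K` floats in equilibrium in every orientation at the level `δ`. -/
def FloatsInEveryOrientation {d : ℕ} (K : Set (EuclideanSpace ℝ (Fin d))) (δ : ENNReal) : Prop :=
  ∀ ξ : EuclideanSpace ℝ (Fin d), ‖ξ‖ = 1 → FloatsInDirection K δ ξ

/-- The body obtained by rotating the graph of `f` over `[a, b]` about the `i`-th coordinate
axis of `ℝᵈ`. -/
def bodyOfRevolution {d : ℕ} (i : Fin d) (a b : ℝ) (f : ℝ → ℝ) :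
    Set (EuclideanSpace ℝ (Fin d)) :=
  {x | x i ∈ Set.Icc a b ∧ ∑ j ∈ Finset.univ.erase i, x j ^ 2 ≤ f (x i) ^ 2}

/-- `L(s, t) = s t + h(s)`. -/
def lineL (h : ℝ → ℝ) (s t : ℝ) : ℝ := s * t + h s

/-- `u < v` are the first coordinates of the two points at which the graph of `ℓ` meets the union
of the graphs of `f` and `-f` over `[a, b]`. -/
def IsChord (a b : ℝ) (f ℓ : ℝ → ℝ) (u v : ℝ) : Prop :=
  u < v ∧ u ∈ Set.Icc a b ∧ v ∈ Set.Icc a b ∧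
    (ℓ u = f u ∨ ℓ u = -f u) ∧ (ℓ v = f v ∨ ℓ v = -f v)

/-- The profile `f₀(t) = √(1 - t²)` of the unit ball. -/
def ballProfile (t : ℝ) : ℝ := √(1 - t ^ 2)

/-- `x₀(s) = y₀(s) = 1 / √(1 + s²)`, the abscissa at which the line `L₀(s, t) = s t` meets the
unit circle. -/
def ballEnd (s : ℝ) : ℝ := 1 / √(1 + s ^ 2)

/-- `∫_{-x₀(s)}^{y₀(s)} (f₀(t)² - L₀(s, t)²)ⁿ dt`, where `L₀(s, t) = s t`. -/
def ballIntegral (n s : ℝ) : ℝ :=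
  ∫ t in (-ballEnd s)..(ballEnd s), (ballProfile t ^ 2 - lineL 0 s t ^ 2) ^ n

end

open MeasureTheory Set Filter Topology

/-! Put `m = d - 2` and `q = m / 2`. The fibre of the body over a point `(t, u)` of the meridian
plane is an `m`-ball of volume proportional to `w = (f t² - u²)₊ ^ q`. By Fubini
(`setIntegral_bodyOfRevolution`) the volume `V(s)` and the first moments `X(s)`, `Y(s)` of the part
below `u = L(s, t)` are, up to a constant, integrals of `w`, `t w`, `u w`. Concavity turns chord
integrals into integrals over the whole interval (`IsChord.integral_eq`), so that no endpoint moves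
with `s`.

Leibniz' rule gives `V' = ∫ w ∂L/∂s`, which is zero by the second identity; hence `V` keeps its
value at `s = 0`, half the volume. Integrating `u w` in `u` raises the exponent to `q + 1`, so the
first identity gives `Y = -k / √(1 + s²)`. As `L = s t + h(s)`, `Y' = s X' + h(s) V' = s X'`, whence
`X - X(0) = k s / √(1 + s²)` (`moments_of_identities`). The moment about the center of mass is thus
a negative multiple of the normal `(-s, 1)`.

The axial direction is the limit `s → ∞`, where `h = 0`. Complementary half-spaces and reflections
that preserve the body give the other directions (`cutBalanced_bodyOfRevolution_of_meridian`). -/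

/-- The real power `x ^ r`, `r ≥ 0`, of the positive part of `x`, as a continuous function. -/
theorem continuous_max_zero_rpow {r : ℝ} (hr : 0 ≤ r) : Continuous fun x : ℝ => (max x 0) ^ r :=
  (continuous_id.max continuous_const).rpow_const fun _ => Or.inr hr

/-! ### Chords of a concave profile. -/

/-- A concave function that is nonnegative at the ends of an interval is nonnegative on it. -/
theorem ConcaveOn.nonneg_of_mem_Icc {s : Set ℝ} {g : ℝ → ℝ} (hg : ConcaveOn ℝ s g) {u v t : ℝ}
    (hu : u ∈ s) (hv : v ∈ s) (ht : t ∈ Icc u v) (gu : 0 ≤ g u) (gv : 0 ≤ g v) : 0 ≤ g t := by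
  have h := hg.min_le_of_mem_Icc hu hv ht
  exact (le_min gu gv).trans h

/-- A concave function that is positive at `p` and vanishes at `q` is nonpositive beyond `q`. -/
theorem ConcaveOn.nonpos_of_pos_of_eq_zero {s : Set ℝ} {g : ℝ → ℝ} (hg : ConcaveOn ℝ s g)
    {p q r : ℝ} (hp : p ∈ s) (hr : r ∈ s) (hpq : q ∈ openSegment ℝ p r) (gp : 0 < g p)
    (gq : g q = 0) : g r ≤ 0 := by
  obtain ⟨a, b, ha, hb, hab, rfl⟩ := hpq
  have h := hg.2 hp hr ha.le hb.le hab
  rw [gq] at h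
  simp only [smul_eq_mul] at h
  by_contra! hc
  nlinarith [mul_pos ha gp, mul_pos hb hc]

theorem ConcaveOn.sub_affine {s : Set ℝ} {f : ℝ → ℝ} (hf : ConcaveOn ℝ s f) (m k : ℝ) :
    ConcaveOn ℝ s fun t => f t - (m * t + k) := by
  refine ⟨hf.1, fun x hx y hy a b ha hb hab => ?_⟩
  have h := hf.2 hx hy ha hb hab
  simp only [smul_eq_mul] at h ⊢
  have : k = a * k + b * k := by rw [← add_mul, hab, one_mul]
  nlinarith

/-- Both `f - ℓ` and `f + ℓ` are concave and nonnegative at the two ends of the chord, hence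
nonnegative between them. -/
theorem IsChord.sq_le_sq_of_mem {a b u v m k : ℝ} {f : ℝ → ℝ} (hf : ConcaveOn ℝ (Icc a b) f)
    (hf0 : ∀ t ∈ Icc a b, 0 ≤ f t) (hc : IsChord a b f (fun t => m * t + k) u v) {t : ℝ}
    (ht : t ∈ Icc u v) : (m * t + k) ^ 2 ≤ f t ^ 2 := by
  obtain ⟨-, hu, hv, eu, ev⟩ := hc
  have fu := hf0 u hu
  have fv := hf0 v hv
  have h1 := (hf.sub_affine m k).nonneg_of_mem_Icc hu hv ht
    (by rcases eu with e | e <;> simp only [e] <;> linarith)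
    (by rcases ev with e | e <;> simp only [e] <;> linarith)
  have h2 := (hf.sub_affine (-m) (-k)).nonneg_of_mem_Icc hu hv ht
    (by rcases eu with e | e <;> linarith)
    (by rcases ev with e | e <;> linarith)
  apply sq_le_sq'
  · linarith
  · linarith

/-- Outside of a chord that passes through the interior, the line is not below the graph. -/
theorem IsChord.sq_le_sq_of_notMem {a b u v m k : ℝ} {f : ℝ → ℝ} (hf : ConcaveOn ℝ (Icc a b) f)
    (hf0 : ∀ t ∈ Icc a b, 0 ≤ f t) (hc : IsChord a b f (fun t => m * t + k) u v) {t₀ : ℝ}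
    (ht₀ : t₀ ∈ Icc u v) (h0 : (m * t₀ + k) ^ 2 < f t₀ ^ 2) {t : ℝ} (ht : t ∈ Icc a b)
    (htu : t ∉ Icc u v) : f t ^ 2 ≤ (m * t + k) ^ 2 := by
  obtain ⟨-, hu, hv, eu, ev⟩ := hc
  have ht₀' : t₀ ∈ Icc a b := ⟨hu.1.trans ht₀.1, ht₀.2.trans hv.2⟩
  obtain ⟨l1, l2⟩ := abs_lt.1 (abs_lt_of_sq_lt_sq h0 (hf0 _ ht₀'))
  -- At the chord end `w` between `t₀` and `t`, one of `f - ℓ`, `f + ℓ` vanishes; it is positive at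
  -- `t₀`, so by concavity it is nonpositive at `t`.
  have key : ∀ w, (w ∈ openSegment ℝ t₀ t) → (m * w + k = f w ∨ m * w + k = -f w) →
      f t ^ 2 ≤ (m * t + k) ^ 2 := by
    intro w hw ew
    have ft := hf0 t ht
    rcases ew with e | e
    · have := (hf.sub_affine m k).nonpos_of_pos_of_eq_zero ht₀' ht hw
        (by linarith) (by linarith)
      apply pow_le_pow_left₀ ft
      linarith
    · have := (hf.sub_affine (-m) (-k)).nonpos_of_pos_of_eq_zero ht₀' ht hw
        (by linarith) (by linarith)
      rw [← neg_sq (m * t + k)]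
      apply pow_le_pow_left₀ ft
      linarith
  have hne : ∀ w, (w = u ∨ w = v) → t₀ ≠ w := by
    rintro w hw rfl
    have : m * t₀ + k = f t₀ ∨ m * t₀ + k = -f t₀ := by rcases hw with rfl | rfl <;> assumption
    rcases this with e | e <;> rw [e] at h0 <;> simp at h0
  rcases lt_or_ge t u with h | h
  · refine key u ?_ eu
    rw [openSegment_symm, openSegment_eq_Ioo (h.trans_le ht₀.1)]
    exact ⟨h, lt_of_le_of_ne ht₀.1 (hne u (Or.inl rfl)).symm⟩
  · have h' : v < t := by
      by_contra! hh
      exact htu ⟨h, hh⟩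
    refine key v ?_ ev
    rw [openSegment_eq_Ioo (ht₀.2.trans_lt h')]
    exact ⟨lt_of_le_of_ne ht₀.2 (hne v (Or.inr rfl)), h'⟩

/-- The integral over a chord of a weighted power of `f² - ℓ²` is the integral over the whole
interval of the same power of its positive part. -/
theorem IsChord.integral_eq {a b u v m k : ℝ} {f : ℝ → ℝ} (hf : ConcaveOn ℝ (Icc a b) f)
    (hf0 : ∀ t ∈ Icc a b, 0 ≤ f t) (hc : IsChord a b f (fun t => m * t + k) u v) {t₀ : ℝ}
    (ht₀ : t₀ ∈ Icc u v) (h0 : (m * t₀ + k) ^ 2 < f t₀ ^ 2) {r : ℝ} (hr : 0 < r) (w : ℝ → ℝ) :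
    ∫ t in u..v, (f t ^ 2 - (m * t + k) ^ 2) ^ r * w t =
      ∫ t in a..b, (max (f t ^ 2 - (m * t + k) ^ 2) 0) ^ r * w t := by
  have huv : u ≤ v := hc.1.le
  have hab : a ≤ b := hc.2.1.1.trans hc.2.1.2
  have hsub : Icc u v ⊆ Icc a b := Icc_subset_Icc hc.2.1.1 hc.2.2.1.2
  rw [intervalIntegral.integral_of_le huv, intervalIntegral.integral_of_le hab,
    ← integral_Icc_eq_integral_Ioc, ← integral_Icc_eq_integral_Ioc]
  symm
  rw [setIntegral_eq_of_subset_of_forall_sdiff_eq_zero measurableSet_Icc hsub]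
  · refine setIntegral_congr_fun measurableSet_Icc fun t ht => ?_
    have := hc.sq_le_sq_of_mem hf hf0 ht
    rw [max_eq_left (by linarith)]
  · intro t ht
    have := hc.sq_le_sq_of_notMem hf hf0 ht₀ h0 ht.1 ht.2
    rw [max_eq_right (by linarith), Real.zero_rpow hr.ne', zero_mul]

/-- A chord along which the integral of a power of `f² - ℓ²` does not vanish passes through the
interior. -/
theorem IsChord.exists_sq_lt_sq {a b u v m k : ℝ} {f : ℝ → ℝ} (hf : ConcaveOn ℝ (Icc a b) f)
    (hf0 : ∀ t ∈ Icc a b, 0 ≤ f t) (hc : IsChord a b f (fun t => m * t + k) u v) {r : ℝ}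
    (hr : 0 < r) (hne : ∫ t in u..v, (f t ^ 2 - (m * t + k) ^ 2) ^ r ≠ 0) :
    ∃ t₀ ∈ Icc u v, (m * t₀ + k) ^ 2 < f t₀ ^ 2 := by
  by_contra! hcon
  refine hne (intervalIntegral.integral_zero_ae (ae_of_all _ fun t ht => ?_))
  rw [uIoc_of_le hc.1.le] at ht
  have ht' := Ioc_subset_Icc_self ht
  have h1 := hcon t ht'
  have h2 := hc.sq_le_sq_of_mem hf hf0 ht'
  rw [show f t ^ 2 - (m * t + k) ^ 2 = 0 by linarith, Real.zero_rpow hr.ne']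

/-! ### The integral for the ball. -/

/-- The substitution `t ↦ √(1 + s²) t` maps the chord onto `[-1, 1]` and removes `s` from the
integrand. -/
theorem ballIntegral_eq (n s : ℝ) :
    ballIntegral n s = (∫ t in (-1 : ℝ)..1, (1 - t ^ 2) ^ n) / √(1 + s ^ 2) := by
  have hpos : 0 < 1 + s ^ 2 := by positivity
  have hq : 0 < √(1 + s ^ 2) := Real.sqrt_pos.2 hpos
  have hq2 : √(1 + s ^ 2) ^ 2 = 1 + s ^ 2 := Real.sq_sqrt hpos.le
  have hq1 : 1 ≤ √(1 + s ^ 2) := by rw [Real.one_le_sqrt]; nlinarith [sq_nonneg s]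
  have h := intervalIntegral.integral_comp_mul_left (a := -ballEnd s) (b := ballEnd s)
    (fun t : ℝ => (1 - t ^ 2) ^ n) hq.ne'
  have e1 : √(1 + s ^ 2) * ballEnd s = 1 := by rw [ballEnd]; field_simp
  rw [mul_neg, e1] at h
  rw [div_eq_inv_mul, ← smul_eq_mul, ← h]
  refine intervalIntegral.integral_congr fun t ht => ?_
  have hb : 0 < ballEnd s := by rw [ballEnd]; positivity
  rw [uIcc_of_le (by linarith)] at ht
  have hb1 : ballEnd s ≤ 1 := by rw [ballEnd, div_le_one hq]; exact hq1
  have ht1 : t ^ 2 ≤ 1 := by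
    rw [sq_le_one_iff_abs_le_one, abs_le]
    exact ⟨by linarith [ht.1], by linarith [ht.2]⟩
  simp only [ballProfile, lineL, Pi.zero_apply]
  rw [Real.sq_sqrt (by linarith), mul_pow, hq2]
  congr 1
  ring

theorem integral_one_sub_sq_rpow_pos {n : ℝ} (hn : 0 ≤ n) :
    0 < ∫ t in (-1 : ℝ)..1, (1 - t ^ 2) ^ n := by
  refine intervalIntegral.intervalIntegral_pos_of_pos_on ?_ ?_ (by norm_num)
  · refine Continuous.intervalIntegrable ?_ _ _
    exact (by fun_prop : Continuous fun t : ℝ => 1 - t ^ 2).rpow_const fun _ => Or.inr hn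
  · intro t ht
    apply Real.rpow_pos_of_pos
    nlinarith [ht.1, ht.2]

/-! ### Derivatives and moments in the meridian plane. -/

/-- Leibniz' rule for the integral of a continuous function over the region below a moving
graph. -/
theorem hasDerivAt_integral_primitive {g : ℝ → ℝ → ℝ} (hg : Continuous g.uncurry)
    {L L' : ℝ → ℝ → ℝ} (hL : Continuous L.uncurry) (hL' : Continuous L'.uncurry)
    (hd : ∀ s t, HasDerivAt (fun σ => L σ t) (L' s t) s) (a b c s : ℝ) :
    HasDerivAt (fun s => ∫ t in a..b, ∫ u in c..L s t, g t u)
      (∫ t in a..b, g t (L s t) * L' s t) s := by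
  have hprim : Continuous fun p : ℝ × ℝ => ∫ u in c..p.2, g p.1 u :=
    intervalIntegral.continuous_parametric_primitive_of_continuous hg
  have hF : ∀ σ, Continuous fun t => ∫ u in c..L σ t, g t u := fun σ =>
    hprim.comp (continuous_id.prodMk (hL.comp (continuous_const.prodMk continuous_id)))
  have hF' : Continuous fun p : ℝ × ℝ => g p.2 (L p.1 p.2) * L' p.1 p.2 :=
    (hg.comp (continuous_snd.prodMk hL)).mul hL'
  -- Compactness of `[s - 1, s + 1] × [a, b]` provides a constant dominating the derivative.
  obtain ⟨C, hC⟩ := ((isCompact_Icc (a := s - 1) (b := s + 1)).prod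
    (isCompact_uIcc (a := a) (b := b))).exists_bound_of_continuousOn hF'.continuousOn
  refine (intervalIntegral.hasDerivAt_integral_of_dominated_loc_of_deriv_le (bound := fun _ => C)
    (F := fun s t => ∫ u in c..L s t, g t u) (F' := fun s t => g t (L s t) * L' s t)
    (Icc_mem_nhds (by linarith : s - 1 < s) (by linarith : s < s + 1))
    (Eventually.of_forall fun σ => (hF σ).aestronglyMeasurable)
    ((hF s).intervalIntegrable _ _)
    (hF'.comp (continuous_const.prodMk continuous_id)).aestronglyMeasurable
    (ae_of_all _ fun t ht σ hσ => hC (σ, t) ⟨hσ, uIoc_subset_uIcc ht⟩)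
    intervalIntegrable_const (ae_of_all _ fun t _ σ _ => ?_)).2
  have hgt : Continuous (g t) := hg.comp (continuous_const.prodMk continuous_id)
  exact (intervalIntegral.integral_hasDerivAt_right (hgt.intervalIntegrable _ _)
    (hgt.stronglyMeasurableAtFilter _ _) hgt.continuousAt).comp σ (hd σ t)

/-- Since `r > 0`, the one-sided derivatives at `0` both vanish and the two branches glue. -/
theorem hasDerivAt_max_zero_rpow {r : ℝ} (hr : 0 < r) (x : ℝ) :
    HasDerivAt (fun x : ℝ => (max x 0) ^ (r + 1)) ((r + 1) * (max x 0) ^ r) x := by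
  have hr1 : r + 1 ≠ 0 := by positivity
  have hpow : ∀ x : ℝ, HasDerivAt (fun x : ℝ => x ^ (r + 1)) ((r + 1) * x ^ r) x := fun x => by
    simpa using Real.hasDerivAt_rpow_const (x := x) (p := r + 1) (Or.inr (by linarith))
  rcases lt_trichotomy x 0 with hx | rfl | hx
  · rw [max_eq_right hx.le, Real.zero_rpow hr.ne', mul_zero]
    refine (hasDerivAt_const x (0 : ℝ)).congr_of_eventuallyEq ?_
    filter_upwards [Iio_mem_nhds hx] with y hy
    rw [max_eq_right (le_of_lt hy), Real.zero_rpow hr1]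
  · rw [max_self, Real.zero_rpow hr.ne', mul_zero, ← hasDerivWithinAt_univ, ← Iic_union_Ici]
    refine HasDerivWithinAt.union ?_ ?_
    · refine (hasDerivWithinAt_const _ _ (0 : ℝ)).congr (fun y hy => ?_) ?_
      · rw [max_eq_right hy, Real.zero_rpow hr1]
      · rw [max_self, Real.zero_rpow hr1]
    · have := (hpow 0).hasDerivWithinAt (s := Ici 0)
      rw [Real.zero_rpow hr.ne', mul_zero] at this
      refine this.congr (fun y hy => ?_) ?_
      · rw [max_eq_left hy]
      · rw [max_self]
  · rw [max_eq_left hx.le]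
    refine (hpow x).congr_of_eventuallyEq ?_
    filter_upwards [Ioi_mem_nhds hx] with y hy
    rw [max_eq_left (le_of_lt hy)]

/-- The weight `((f t)² - u²)₊ ^ q`: up to a constant factor, the volume of the slice of the body
of revolution lying above the point `(t, u)` of the meridian plane. -/
noncomputable def sliceWeight (f : ℝ → ℝ) (q t u : ℝ) : ℝ := (max (f t ^ 2 - u ^ 2) 0) ^ q

theorem continuous_sliceWeight {f : ℝ → ℝ} (hf : Continuous f) {q : ℝ} (hq : 0 ≤ q) :
    Continuous fun p : ℝ × ℝ => sliceWeight f q p.1 p.2 :=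
  (continuous_max_zero_rpow hq).comp
    (by fun_prop : Continuous fun p : ℝ × ℝ => f p.1 ^ 2 - p.2 ^ 2)

theorem sliceWeight_neg (f : ℝ → ℝ) (q t u : ℝ) : sliceWeight f q t (-u) = sliceWeight f q t u := by
  simp [sliceWeight]

theorem sliceWeight_eq_zero {f : ℝ → ℝ} {q t u : ℝ} (hq : 0 < q) (h : f t ^ 2 ≤ u ^ 2) :
    sliceWeight f q t u = 0 := by
  rw [sliceWeight, max_eq_right (by linarith), Real.zero_rpow hq.ne']

/-- The first moment of the slice weight below a given height. -/
theorem integral_mul_sliceWeight {f : ℝ → ℝ} (hf : Continuous f) {q : ℝ} (hq : 0 < q) {M : ℝ}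
    (hM : ∀ t, f t ^ 2 ≤ M ^ 2) (t v : ℝ) :
    ∫ u in (-M)..v, u * sliceWeight f q t u = -(1 / (2 * (q + 1))) * sliceWeight f (q + 1) t v := by
  have hd : ∀ u, HasDerivAt (fun u => -(1 / (2 * (q + 1))) * sliceWeight f (q + 1) t u)
      (u * sliceWeight f q t u) u := by
    intro u
    have h1 : HasDerivAt (fun u : ℝ => f t ^ 2 - u ^ 2) (-(2 * u)) u := by
      simpa using (hasDerivAt_pow 2 u).const_sub (f t ^ 2)
    have h2 := ((hasDerivAt_max_zero_rpow hq (f t ^ 2 - u ^ 2)).comp u h1).const_mul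
      (-(1 / (2 * (q + 1))))
    refine h2.congr_deriv ?_
    rw [sliceWeight]
    field_simp
  rw [intervalIntegral.integral_eq_sub_of_hasDerivAt (fun u _ => hd u)]
  -- The boundary term at `-M` vanishes because `f² ≤ M²`.
  · rw [sliceWeight_eq_zero (u := -M) (by positivity) (by simpa using hM t)]
    ring
  · refine Continuous.intervalIntegrable ?_ _ _
    exact continuous_id.mul
      ((continuous_sliceWeight hf hq.le).comp (continuous_const.prodMk continuous_id))

/-- A continuous function on `[0, ∞)` whose derivative vanishes on `(0, ∞)` is constant. -/
theorem eq_of_hasDerivAt_zero {F : ℝ → ℝ} (hF : Continuous F)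
    (hd : ∀ s, 0 < s → HasDerivAt F 0 s) {s : ℝ} (hs : 0 ≤ s) : F s = F 0 := by
  rcases hs.eq_or_lt with rfl | hs
  · rfl
  obtain ⟨c, -, hc⟩ := exists_hasDerivAt_eq_slope F (fun _ => 0) hs hF.continuousOn
    fun x hx => hd x hx.1
  rw [eq_comm, div_eq_zero_iff, sub_zero, sub_eq_zero] at hc
  exact hc.resolve_right hs.ne'

theorem hasDerivAt_inv_sqrt_one_add_sq (s : ℝ) :
    HasDerivAt (fun s : ℝ => 1 / √(1 + s ^ 2)) (-s / √(1 + s ^ 2) ^ 3) s := by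
  have hpos : 0 < 1 + s ^ 2 := by positivity
  have hq : 0 < √(1 + s ^ 2) := Real.sqrt_pos.2 hpos
  have h1 : HasDerivAt (fun s : ℝ => 1 + s ^ 2) (2 * s) s := by
    simpa using (hasDerivAt_pow 2 s).const_add 1
  have h2 := (h1.sqrt hpos.ne').fun_inv hq.ne'
  simp only [one_div]
  refine h2.congr_deriv ?_
  field_simp

theorem hasDerivAt_mul_inv_sqrt_one_add_sq (s : ℝ) :
    HasDerivAt (fun s : ℝ => s / √(1 + s ^ 2)) (1 / √(1 + s ^ 2) ^ 3) s := by
  have hpos : 0 < 1 + s ^ 2 := by positivity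
  have hq : 0 < √(1 + s ^ 2) := Real.sqrt_pos.2 hpos
  have hq2 : √(1 + s ^ 2) ^ 2 = 1 + s ^ 2 := Real.sq_sqrt hpos.le
  have h2 := (hasDerivAt_id s).mul (hasDerivAt_inv_sqrt_one_add_sq s)
  refine (h2.congr_deriv ?_).congr_of_eventuallyEq (Eventually.of_forall fun x => ?_)
  · simp only [id]
    field_simp
    rw [hq2]
    ring
  · simp [div_eq_mul_inv]

/-- The volume and the first moments of the part of the meridian section below the line
`u = s t + h(s)`, as functions of `s ≥ 0`. -/
theorem moments_of_identities {f : ℝ → ℝ} (hf : Continuous f) {q : ℝ} (hq : 0 < q) {M : ℝ}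
    (hM : ∀ t, f t ^ 2 ≤ M ^ 2) {h : ℝ → ℝ} (hh : ContDiff ℝ ∞ h) {a b c : ℝ}
    (hmoment : ∀ s : ℝ, 0 < s →
      ∫ t in a..b, sliceWeight f (q + 1) t (s * t + h s) = c / √(1 + s ^ 2))
    (hcenter : ∀ s : ℝ, 0 < s →
      ∫ t in a..b, sliceWeight f q t (s * t + h s) * (t + deriv h s) = 0)
    {s : ℝ} (hs : 0 ≤ s) :
    (∫ t in a..b, ∫ u in (-M)..(s * t + h s), sliceWeight f q t u) =
        ∫ t in a..b, ∫ u in (-M)..h 0, sliceWeight f q t u ∧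
    (∫ t in a..b, ∫ u in (-M)..(s * t + h s), t * sliceWeight f q t u) =
        (∫ t in a..b, ∫ u in (-M)..h 0, t * sliceWeight f q t u) +
          c / (2 * (q + 1)) * (s / √(1 + s ^ 2)) ∧
    (∫ t in a..b, ∫ u in (-M)..(s * t + h s), u * sliceWeight f q t u) =
        -(c / (2 * (q + 1)) * (1 / √(1 + s ^ 2))) := by
  have hφ := continuous_sliceWeight hf hq.le
  have hL : Continuous (fun s t : ℝ => s * t + h s).uncurry :=
    (continuous_fst.mul continuous_snd).add (hh.continuous.comp continuous_fst)
  have hh' : Continuous (deriv h) := hh.continuous_deriv (by simp)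
  have hL' : Continuous (fun s t : ℝ => t + deriv h s).uncurry :=
    continuous_snd.add (hh'.comp continuous_fst)
  have hd : ∀ s t : ℝ, HasDerivAt (fun σ => σ * t + h σ) (t + deriv h s) s := fun s t => by
    have := (hh.differentiable (by simp) s).hasDerivAt
    exact (hasDerivAt_mul_const t).fun_add this
  have dV := hasDerivAt_integral_primitive (g := fun t u => sliceWeight f q t u) hφ hL hL' hd a b (-M)
  have dX := hasDerivAt_integral_primitive (g := fun t u => t * sliceWeight f q t u)
    (continuous_fst.mul hφ) hL hL' hd a b (-M)
  have dY := hasDerivAt_integral_primitive (g := fun t u => u * sliceWeight f q t u)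
    (continuous_snd.mul hφ) hL hL' hd a b (-M)
  have cX := continuous_iff_continuousAt.2 fun s => (dX s).continuousAt
  have cY := continuous_iff_continuousAt.2 fun s => (dY s).continuousAt
  have cV := continuous_iff_continuousAt.2 fun s => (dV s).continuousAt
  have hY : ∀ s, 0 < s → (∫ t in a..b, ∫ u in (-M)..(s * t + h s), u * sliceWeight f q t u) =
        -(c / (2 * (q + 1)) * (1 / √(1 + s ^ 2))) := by
    intro s hs
    simp only [integral_mul_sliceWeight hf hq hM]
    rw [intervalIntegral.integral_const_mul, hmoment s hs]
    ring
  have cR : Continuous fun s : ℝ => -(c / (2 * (q + 1)) * (1 / √(1 + s ^ 2))) :=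
    continuous_iff_continuousAt.2 fun s =>
      ((hasDerivAt_inv_sqrt_one_add_sq s).const_mul _).neg.continuousAt
  refine ⟨?_, ?_, ?_⟩
  · have := eq_of_hasDerivAt_zero cV (fun s hs => (dV s).congr_deriv (hcenter s hs)) hs
    simpa using this
  · have key : ∀ s, 0 < s → HasDerivAt (fun s : ℝ =>
        (∫ t in a..b, ∫ u in (-M)..(s * t + h s), t * sliceWeight f q t u) -
          c / (2 * (q + 1)) * (s / √(1 + s ^ 2))) 0 s := by
      intro s hs
      refine ((dX s).sub ((hasDerivAt_mul_inv_sqrt_one_add_sq s).const_mul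
        (c / (2 * (q + 1))))).congr_deriv ?_
      -- Two values of `Y'`: Leibniz' rule, and the derivative of the closed form, valid near any `s
      -- > 0`.
      have e1 := (dY s).unique ((((hasDerivAt_inv_sqrt_one_add_sq s).const_mul
        (c / (2 * (q + 1)))).neg).congr_of_eventuallyEq
          (by filter_upwards [Ioi_mem_nhds hs] with y hy using hY y hy))
      have i1 : Continuous fun t => t * sliceWeight f q t (s * t + h s) * (t + deriv h s) :=
        (continuous_id.mul (hφ.comp (continuous_id.prodMk (by fun_prop)))).mul (by fun_prop)
      have i2 : Continuous fun t => sliceWeight f q t (s * t + h s) * (t + deriv h s) :=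
        (hφ.comp (continuous_id.prodMk (by fun_prop))).mul (by fun_prop)
      -- This is `Y' = s X'`: the `h s` term is a multiple of the second identity.
      have e2 : ∫ t in a..b, (s * t + h s) * sliceWeight f q t (s * t + h s) * (t + deriv h s) =
          s * ∫ t in a..b, t * sliceWeight f q t (s * t + h s) * (t + deriv h s) := by
        have : ∀ t, (s * t + h s) * sliceWeight f q t (s * t + h s) * (t + deriv h s) =
            s * (t * sliceWeight f q t (s * t + h s) * (t + deriv h s)) +
              h s * (sliceWeight f q t (s * t + h s) * (t + deriv h s)) := fun t => by ring
        simp only [this]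
        rw [intervalIntegral.integral_add ((i1.const_mul s).intervalIntegrable _ _)
          ((i2.const_mul (h s)).intervalIntegrable _ _), intervalIntegral.integral_const_mul,
          intervalIntegral.integral_const_mul, hcenter s hs, mul_zero, add_zero]
      rw [e2] at e1
      have := mul_left_cancel₀ hs.ne' (e1.trans (by ring :
        -(c / (2 * (q + 1)) * (-s / √(1 + s ^ 2) ^ 3)) =
          s * (c / (2 * (q + 1)) * (1 / √(1 + s ^ 2) ^ 3))))
      rw [this, sub_self]
    have cS : Continuous fun s : ℝ => c / (2 * (q + 1)) * (s / √(1 + s ^ 2)) :=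
      continuous_iff_continuousAt.2 fun s =>
        ((hasDerivAt_mul_inv_sqrt_one_add_sq s).const_mul _).continuousAt
    have := eq_of_hasDerivAt_zero (cX.sub cS) key hs
    simp only [Pi.sub_apply, zero_mul, zero_add, zero_div, mul_zero, sub_zero] at this
    linarith
  -- The identities are given only for `s > 0`; the value at `s = 0` follows by continuity.
  · have : Ioi (0 : ℝ) ⊆ {s | (∫ t in a..b, ∫ u in (-M)..(s * t + h s), u * sliceWeight f q t u) =
        -(c / (2 * (q + 1)) * (1 / √(1 + s ^ 2)))} := fun s hs => hY s hs
    have := (isClosed_eq cY cR).closure_subset_iff.2 this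
    rw [closure_Ioi] at this
    exact this hs

/-! ### Fubini's theorem for the body of revolution. -/

theorem volume_real_setOf_sum_sq_le {m : ℕ} (hm : 0 < m) (r : ℝ) :
    volume.real {y : Fin m → ℝ | ∑ j, y j ^ 2 ≤ r} =
      volume.real (Metric.ball (0 : EuclideanSpace ℝ (Fin m)) 1) * (max r 0) ^ ((m : ℝ) / 2) := by
  rcases lt_or_ge r 0 with hr | hr
  · have : {y : Fin m → ℝ | ∑ j, y j ^ 2 ≤ r} = ∅ := by
      ext y
      simp only [mem_ofPred_eq, mem_empty_iff_false, iff_false, not_le]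
      exact hr.trans_le (Finset.sum_nonneg fun _ _ => sq_nonneg _)
    rw [this, measureReal_empty, max_eq_right hr.le, Real.zero_rpow (by positivity), mul_zero]
  · have h1 : (WithLp.ofLp : EuclideanSpace ℝ (Fin m) → Fin m → ℝ) ⁻¹'
        {y : Fin m → ℝ | ∑ j, y j ^ 2 ≤ r} = Metric.closedBall 0 (√r) := by
      ext y
      rw [mem_closedBall_zero_iff, EuclideanSpace.norm_eq]
      simp only [mem_preimage, mem_ofPred_eq, Real.norm_eq_abs, sq_abs]
      rw [Real.sqrt_le_sqrt_iff hr]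
    have hmeas : MeasurableSet {y : Fin m → ℝ | ∑ j, y j ^ 2 ≤ r} :=
      (isClosed_le (by fun_prop) continuous_const).measurableSet
    rw [measureReal_def, ← (PiLp.volume_preserving_ofLp (Fin m)).measure_preimage
      hmeas.nullMeasurableSet, h1, ← measureReal_def,
      Measure.addHaar_real_closedBall _ _ (Real.sqrt_nonneg r), finrank_euclideanSpace_fin,
      max_eq_left hr, mul_comm, Real.sqrt_eq_rpow, ← Real.rpow_natCast, ← Real.rpow_mul hr]
    congr 2
    ring

/-- The splitting of a point of `ℝ^(m+2)` into its first two and its remaining coordinates. -/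
def splitTwo (m : ℕ) (p : EuclideanSpace ℝ (Fin (m + 2))) : ℝ × ℝ × (Fin m → ℝ) :=
  (p 0, p 1, fun j => p j.succ.succ)

theorem measurePreserving_splitTwo (m : ℕ) : MeasurePreserving (splitTwo m) := by
  have h1 := volume_preserving_piFinSuccAbove (fun _ : Fin (m + 2) => ℝ) 0
  have h2 := volume_preserving_piFinSuccAbove (fun _ : Fin (m + 1) => ℝ) 0
  have h3 := (((MeasurePreserving.id (volume : Measure ℝ)).prod h2).comp h1).comp
    (PiLp.volume_preserving_ofLp (Fin (m + 2)))
  exact h3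

/-- The part of the body of revolution below a graph, in split coordinates. -/
def splitBody (m : ℕ) (a b : ℝ) (f ℓ : ℝ → ℝ) : Set (ℝ × ℝ × (Fin m → ℝ)) :=
  {z | z.1 ∈ Icc a b ∧ z.2.1 ≤ ℓ z.1 ∧ ∑ j, z.2.2 j ^ 2 ≤ f z.1 ^ 2 - z.2.1 ^ 2}

theorem isCompact_splitBody {m : ℕ} {a b M : ℝ} {f ℓ : ℝ → ℝ} (hf : Continuous f)
    (hℓ : Continuous ℓ) (hM0 : 0 ≤ M) (hM : ∀ t, f t ^ 2 ≤ M ^ 2) :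
    IsCompact (splitBody m a b f ℓ) := by
  refine ((isCompact_Icc (a := a) (b := b)).prod ((isCompact_Icc (a := -M) (b := M)).prod
    (isCompact_univ_pi fun _ : Fin m => isCompact_Icc (a := -M) (b := M)))).of_isClosed_subset ?_ ?_
  · have c1 : IsClosed {z : ℝ × ℝ × (Fin m → ℝ) | z.2.1 ≤ ℓ z.1} :=
      isClosed_le (by fun_prop) (by fun_prop)
    have c2 : IsClosed {z : ℝ × ℝ × (Fin m → ℝ) | ∑ j, z.2.2 j ^ 2 ≤ f z.1 ^ 2 - z.2.1 ^ 2} :=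
      isClosed_le (by fun_prop) (by fun_prop)
    exact (isClosed_Icc.preimage continuous_fst).inter (c1.inter c2)
  · rintro ⟨t, u, y⟩ ⟨h1, -, h3⟩
    simp only at h1 h3
    have hs : 0 ≤ ∑ j, y j ^ 2 := Finset.sum_nonneg fun _ _ => sq_nonneg _
    have := hM t
    refine ⟨h1, abs_le.1 (abs_le_of_sq_le_sq (by linarith) hM0), fun j _ => ?_⟩
    have hj : y j ^ 2 ≤ ∑ j, y j ^ 2 :=
      Finset.single_le_sum (f := fun j => y j ^ 2) (fun _ _ => sq_nonneg _) (Finset.mem_univ j)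
    exact abs_le.1 (abs_le_of_sq_le_sq (by nlinarith [sq_nonneg u]) hM0)

theorem bodyOfRevolution_inter_eq {m : ℕ} (a b : ℝ) (f ℓ : ℝ → ℝ) :
    bodyOfRevolution (0 : Fin (m + 2)) a b f ∩ {p | p 1 ≤ ℓ (p 0)} =
      splitTwo m ⁻¹' splitBody m a b f ℓ := by
  ext p
  have : ∑ j ∈ Finset.univ.erase (0 : Fin (m + 2)), p j ^ 2 =
      p 1 ^ 2 + ∑ j : Fin m, p j.succ.succ ^ 2 := by
    have h1 := Finset.add_sum_erase Finset.univ (fun j => p j ^ 2) (Finset.mem_univ (0 : Fin (m + 2)))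
    rw [Fin.sum_univ_succ, Fin.sum_univ_succ, Fin.succ_zero_eq_one] at h1
    linarith
  simp only [bodyOfRevolution, splitBody, splitTwo, mem_inter_iff, mem_ofPred_eq, mem_preimage, this]
  constructor
  · rintro ⟨⟨h1, h2⟩, h3⟩
    exact ⟨h1, h3, by linarith⟩
  · rintro ⟨h1, h3, h2⟩
    exact ⟨⟨h1, by linarith⟩, h3⟩

theorem setIntegral_Iic_eq_of_eq_zero {g : ℝ → ℝ} (hg : Continuous g) {M : ℝ}
    (h0 : ∀ u, M ≤ |u| → g u = 0) (v : ℝ) : ∫ u in Iic v, g u = ∫ u in (-M)..v, g u := by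
  have hc : HasCompactSupport g := by
    refine HasCompactSupport.intro (isCompact_Icc (a := -M) (b := M)) fun u hu => h0 u ?_
    by_contra! h
    exact hu (abs_le.1 h.le)
  have hi := hg.integrable_of_hasCompactSupport hc (μ := volume)
  rw [← intervalIntegral.integral_Iic_sub_Iic hi.integrableOn hi.integrableOn,
    setIntegral_eq_zero_of_forall_eq_zero (t := Iic (-M)), sub_zero]
  intro u hu
  apply h0
  have : u ≤ -M := hu
  exact (by linarith : M ≤ -u).trans (neg_le_abs u)

/-- Fubini's theorem for the part of a body of revolution below a graph over its axis. -/
theorem setIntegral_bodyOfRevolution {m : ℕ} (hm : 0 < m) {a b M : ℝ} (hab : a ≤ b) {f ℓ : ℝ → ℝ}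
    (hf : Continuous f) (hℓ : Continuous ℓ) (hM0 : 0 ≤ M) (hM : ∀ t, f t ^ 2 ≤ M ^ 2)
    {P : ℝ → ℝ → ℝ} (hP : Continuous P.uncurry) :
    ∫ p in bodyOfRevolution (0 : Fin (m + 2)) a b f ∩ {p | p 1 ≤ ℓ (p 0)}, P (p 0) (p 1) =
      volume.real (Metric.ball (0 : EuclideanSpace ℝ (Fin m)) 1) *
        ∫ t in a..b, ∫ u in (-M)..ℓ t, P t u * sliceWeight f ((m : ℝ) / 2) t u := by
  set κ := volume.real (Metric.ball (0 : EuclideanSpace ℝ (Fin m)) 1)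
  have hq : (0 : ℝ) < (m : ℝ) / 2 := by positivity
  have hcomp := isCompact_splitBody (m := m) (a := a) (b := b) hf hℓ hM0 hM
  have hPz : Continuous fun z : ℝ × ℝ × (Fin m → ℝ) => P z.1 z.2.1 :=
    hP.comp (continuous_fst.prodMk (continuous_fst.comp continuous_snd))
  have hmp := measurePreserving_splitTwo m
  have h1 : ∫ p in bodyOfRevolution (0 : Fin (m + 2)) a b f ∩ {p | p 1 ≤ ℓ (p 0)}, P (p 0) (p 1) =
      ∫ z in splitBody m a b f ℓ, P z.1 z.2.1 := by
    rw [← hmp.map_eq, setIntegral_map hcomp.measurableSet hPz.aestronglyMeasurable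
      hmp.measurable.aemeasurable, bodyOfRevolution_inter_eq]
    rfl
  have hint : Integrable ((splitBody m a b f ℓ).indicator fun z => P z.1 z.2.1) :=
    (integrable_indicator_iff hcomp.measurableSet).2 (hPz.continuousOn.integrableOn_compact hcomp)
  have hind : ∀ t u y, (splitBody m a b f ℓ).indicator (fun z => P z.1 z.2.1) (t, u, y) =
      (Icc a b).indicator (fun t => (Iic (ℓ t)).indicator (fun u => P t u *
        ({y : Fin m → ℝ | ∑ j, y j ^ 2 ≤ f t ^ 2 - u ^ 2}.indicator 1 y)) u) t := by
    intro t u y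
    by_cases ht : t ∈ Icc a b
    · by_cases hu : u ≤ ℓ t
      · by_cases hy : ∑ j, y j ^ 2 ≤ f t ^ 2 - u ^ 2
        · rw [indicator_of_mem (show (t, u, y) ∈ splitBody m a b f ℓ from ⟨ht, hu, hy⟩),
            indicator_of_mem ht, indicator_of_mem (show u ∈ Iic (ℓ t) from hu),
            indicator_of_mem (by exact hy)]
          simp
        · rw [indicator_of_notMem (show (t, u, y) ∉ splitBody m a b f ℓ from fun h => hy h.2.2),
            indicator_of_mem ht, indicator_of_mem (show u ∈ Iic (ℓ t) from hu),
            indicator_of_notMem (by exact hy)]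
          simp
      · rw [indicator_of_notMem (show (t, u, y) ∉ splitBody m a b f ℓ from fun h => hu h.2.1),
          indicator_of_mem ht, indicator_of_notMem (show u ∉ Iic (ℓ t) from hu)]
    · rw [indicator_of_notMem (show (t, u, y) ∉ splitBody m a b f ℓ from fun h => ht h.1),
        indicator_of_notMem ht]
  rw [h1, ← integral_indicator hcomp.measurableSet, Measure.volume_eq_prod,
    integral_prod _ hint]
  -- Only almost every section is known to be integrable, which is what the inner use of Fubini
  -- needs.
  have h2 : ∀ᵐ t : ℝ, ∫ w : ℝ × (Fin m → ℝ),
      (splitBody m a b f ℓ).indicator (fun z => P z.1 z.2.1) (t, w) =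
      (Icc a b).indicator (fun t => κ * ∫ u in (-M)..ℓ t, P t u * sliceWeight f ((m : ℝ) / 2) t u) t := by
    filter_upwards [hint.prod_right_ae] with t ht
    rw [Measure.volume_eq_prod, integral_prod _ ht]
    simp only [hind]
    by_cases hta : t ∈ Icc a b
    · simp only [indicator_of_mem hta]
      have h3 : ∀ u, ∫ y : Fin m → ℝ, (Iic (ℓ t)).indicator (fun u => P t u *
          ({y : Fin m → ℝ | ∑ j, y j ^ 2 ≤ f t ^ 2 - u ^ 2}.indicator 1 y)) u =
          (Iic (ℓ t)).indicator (fun u => κ * (P t u * sliceWeight f ((m : ℝ) / 2) t u)) u := by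
        intro u
        by_cases hu : u ∈ Iic (ℓ t)
        · simp only [indicator_of_mem hu]
          rw [integral_const_mul, integral_indicator_one
            (isClosed_le (by fun_prop) continuous_const).measurableSet,
            volume_real_setOf_sum_sq_le hm, sliceWeight]
          ring
        · simp only [indicator_of_notMem hu, integral_zero]
      simp only [h3]
      rw [integral_indicator measurableSet_Iic, integral_const_mul, setIntegral_Iic_eq_of_eq_zero]
      · exact (hP.comp (continuous_const.prodMk continuous_id)).mul
          ((continuous_sliceWeight hf hq.le).comp (continuous_const.prodMk continuous_id))
      · intro u hu
        rw [sliceWeight_eq_zero hq, mul_zero]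
        exact (hM t).trans (by rw [← sq_abs u]; exact pow_le_pow_left₀ hM0 hu 2)
    · simp only [indicator_of_notMem hta, integral_zero]
  rw [integral_congr_ae h2, integral_indicator measurableSet_Icc, integral_const_mul,
    intervalIntegral.integral_of_le hab, integral_Icc_eq_integral_Ioc]

/-! ### Balanced cuts and their invariances. -/

/-- The hyperplane in `IsCuttingLevel` bisects `K`, and the first moment of the submerged part
about the center of mass of `K` is a nonzero multiple of `ξ`. -/
def CutBalanced {d : ℕ} (K : Set (EuclideanSpace ℝ (Fin d))) (ξ : EuclideanSpace ℝ (Fin d)) :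
    Prop :=
  ∃ t : ℝ, volume.real (K ∩ lowerHalfSpace ξ t) = volume.real K / 2 ∧
    ∃ c : ℝ, c ≠ 0 ∧ ∫ p in K ∩ lowerHalfSpace ξ t, (p - centerOfMass K) = c • ξ

section
variable {d : ℕ} {K : Set (EuclideanSpace ℝ (Fin d))} {ξ : EuclideanSpace ℝ (Fin d)}

theorem isClosed_lowerHalfSpace (ξ : EuclideanSpace ℝ (Fin d)) (t : ℝ) :
    IsClosed (lowerHalfSpace ξ t) :=
  isClosed_le (by fun_prop) continuous_const

theorem volume_hyperplane (hξ : ξ ≠ 0) (t : ℝ) :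
    volume {p : EuclideanSpace ℝ (Fin d) | inner ℝ p ξ = t} = 0 := by
  -- The hyperplane is a translate, by `(t / ‖ξ‖²) ξ`, of this proper subspace.
  have h0 : volume ((ℝ ∙ ξ)ᗮ : Set (EuclideanSpace ℝ (Fin d))) = 0 := by
    apply Measure.addHaar_submodule
    rw [Ne, Submodule.orthogonal_eq_top_iff, Submodule.span_singleton_eq_bot]
    exact hξ
  rw [← measure_preimage_add_right volume (-((t / ‖ξ‖ ^ 2) • ξ))] at h0
  convert h0 using 2
  ext p
  have : ‖ξ‖ ^ 2 ≠ 0 := by positivity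
  simp only [mem_ofPred_eq, mem_preimage, SetLike.mem_coe, Submodule.mem_orthogonal_singleton_iff_inner_left,
    inner_add_left, inner_neg_left, real_inner_smul_left, real_inner_self_eq_norm_sq]
  rw [div_mul_cancel₀ _ this]
  constructor <;> intro h <;> linarith

theorem setIntegral_sub_eq_smul {A : Set (EuclideanSpace ℝ (Fin d))} (hA : volume.real A ≠ 0)
    (hi : IntegrableOn (fun p => p) A) (c : EuclideanSpace ℝ (Fin d)) :
    ∫ p in A, (p - c) = volume.real A • (centerOfMass A - c) := by
  have hfin : volume A ≠ ⊤ := fun h => hA (by simp [measureReal_def, h])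
  rw [integral_sub hi (integrableOn_const hfin), setIntegral_const, centerOfMass, setAverage_eq,
    smul_sub, smul_inv_smul₀ hA]

theorem IsCompact.integrableOn_id' (hK : IsCompact K) : IntegrableOn (fun p => p) K :=
  continuous_id.continuousOn.integrableOn_compact hK

theorem IsCompact.integrableOn_sub_const (hK : IsCompact K) (c : EuclideanSpace ℝ (Fin d)) :
    IntegrableOn (fun p => p - c) K :=
  (continuous_id.sub continuous_const).continuousOn.integrableOn_compact hK

theorem setIntegral_sub_centerOfMass (hK : IsCompact K) :
    ∫ p in K, (p - centerOfMass K) = 0 := by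
  by_cases h : volume.real K = 0
  · rw [measureReal_eq_zero_iff hK.measure_ne_top] at h
    exact setIntegral_measure_zero _ h
  · rw [setIntegral_sub_eq_smul h hK.integrableOn_id', sub_self, smul_zero]

theorem CutBalanced.floatsInDirection (hK : IsCompact K) (hξ : ξ ≠ 0) (h : CutBalanced K ξ) :
    FloatsInDirection K (volume K / 2) ξ := by
  obtain ⟨t, hv, c, hc, hm⟩ := h
  set A := K ∩ lowerHalfSpace ξ t
  have hAc : IsCompact A := hK.inter_right (isClosed_lowerHalfSpace ξ t)
  have hA : volume.real A ≠ 0 := by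
    intro h0
    rw [measureReal_eq_zero_iff hAc.measure_ne_top] at h0
    rw [setIntegral_measure_zero _ h0, eq_comm, smul_eq_zero] at hm
    exact hm.elim hc hξ
  refine ⟨t, ?_, ?_⟩
  · change volume A = volume K / 2
    rw [← ENNReal.toReal_eq_toReal_iff' hAc.measure_ne_top
      (ENNReal.div_ne_top hK.measure_ne_top (by norm_num)), ENNReal.toReal_div]
    exact hv
  · rw [setIntegral_sub_eq_smul hA hAc.integrableOn_id'] at hm
    have : centerOfMass A - centerOfMass K = ((volume.real A)⁻¹ * c) • ξ := by
      rw [mul_smul, ← hm, inv_smul_smul₀ hA]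
    rw [direction_affineSpan, vectorSpan_pair_rev, vsub_eq_sub, this]
    exact Submodule.span_singleton_smul_eq (mul_ne_zero (inv_ne_zero hA) hc).isUnit _

/-- The opposite half-space cuts off the complement up to a null hyperplane. The moments of the two
parts about the center of mass of `K` sum to zero, so the same `c` serves for `-ξ`. -/
theorem CutBalanced.neg (hK : IsCompact K) (hξ : ξ ≠ 0) (h : CutBalanced K ξ) :
    CutBalanced K (-ξ) := by
  obtain ⟨t, hv, c, hc, hm⟩ := h
  have hH := (isClosed_lowerHalfSpace ξ t).measurableSet
  have hae : (K ∩ lowerHalfSpace (-ξ) (-t) : Set _) =ᵐ[volume] (K \ lowerHalfSpace ξ t : Set _) := by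
    have := measure_eq_zero_iff_ae_notMem.1 (volume_hyperplane hξ t)
    filter_upwards [this] with p hp
    apply propext
    change (p ∈ K ∧ inner ℝ p (-ξ) ≤ -t) ↔ (p ∈ K ∧ ¬ inner ℝ p ξ ≤ t)
    rw [inner_neg_right, neg_le_neg_iff, not_le]
    exact and_congr_right fun _ => ⟨fun h => lt_of_le_of_ne h (Ne.symm hp), le_of_lt⟩
  refine ⟨-t, ?_, c, hc, ?_⟩
  · rw [measureReal_congr hae]
    have := measureReal_inter_add_sdiff (μ := volume) (s := K) hH hK.measure_ne_top
    linarith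
  · rw [setIntegral_congr_set hae]
    have := integral_inter_add_sdiff hH (hK.integrableOn_sub_const (centerOfMass K))
    rw [setIntegral_sub_centerOfMass hK, hm] at this
    rw [smul_neg]
    exact eq_neg_of_add_eq_zero_right this

theorem CutBalanced.of_smul {c : ℝ} (hc : 0 < c) (h : CutBalanced K (c • ξ)) : CutBalanced K ξ := by
  obtain ⟨t, hv, r, hr, hm⟩ := h
  have : lowerHalfSpace ξ (t / c) = lowerHalfSpace (c • ξ) t := by
    ext p
    simp only [lowerHalfSpace, mem_ofPred_eq, real_inner_smul_right]
    rw [le_div_iff₀ hc, mul_comm]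
  refine ⟨t / c, ?_, r * c, mul_ne_zero hr hc.ne', ?_⟩
  · rw [this, hv]
  · rw [this, hm, smul_smul]

theorem setIntegral_preimage_isometry (ρ : EuclideanSpace ℝ (Fin d) ≃ₗᵢ[ℝ] EuclideanSpace ℝ (Fin d))
    {G : Type*} [NormedAddCommGroup G] [NormedSpace ℝ G]
    (A : Set (EuclideanSpace ℝ (Fin d))) (F : EuclideanSpace ℝ (Fin d) → G) :
    ∫ p in ρ ⁻¹' A, F (ρ p) = ∫ p in A, F p :=
  ρ.measurePreserving.setIntegral_preimage_emb ρ.toHomeomorph.measurableEmbedding F A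

theorem setIntegral_preimage_isometry_sub
    (ρ : EuclideanSpace ℝ (Fin d) ≃ₗᵢ[ℝ] EuclideanSpace ℝ (Fin d))
    (A : Set (EuclideanSpace ℝ (Fin d))) (c : EuclideanSpace ℝ (Fin d)) :
    ρ (∫ p in ρ ⁻¹' A, (p - c)) = ∫ p in A, (p - ρ c) := by
  rw [← setIntegral_preimage_isometry ρ A fun p => p - ρ c]
  have := ρ.toContinuousLinearEquiv.integral_comp_comm (μ := volume.restrict (ρ ⁻¹' A))
    (fun p => p - c)
  simp only [map_sub] at this
  exact this.symm

theorem volume_real_preimage_isometry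
    (ρ : EuclideanSpace ℝ (Fin d) ≃ₗᵢ[ℝ] EuclideanSpace ℝ (Fin d))
    (A : Set (EuclideanSpace ℝ (Fin d))) : volume.real (ρ ⁻¹' A) = volume.real A := by
  rw [measureReal_def, ρ.measurePreserving.measure_preimage_emb
    ρ.toHomeomorph.measurableEmbedding, measureReal_def]

theorem centerOfMass_preimage_isometry
    (ρ : EuclideanSpace ℝ (Fin d) ≃ₗᵢ[ℝ] EuclideanSpace ℝ (Fin d))
    (A : Set (EuclideanSpace ℝ (Fin d))) : ρ (centerOfMass (ρ ⁻¹' A)) = centerOfMass A := by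
  have := setIntegral_preimage_isometry_sub ρ A 0
  simp only [map_zero, sub_zero] at this
  rw [centerOfMass, centerOfMass, setAverage_eq, setAverage_eq, map_smul, this,
    volume_real_preimage_isometry]

theorem CutBalanced.of_isometry {ρ : EuclideanSpace ℝ (Fin d) ≃ₗᵢ[ℝ] EuclideanSpace ℝ (Fin d)}
    (hρ : ρ ⁻¹' K = K) (h : CutBalanced K (ρ ξ)) : CutBalanced K ξ := by
  obtain ⟨t, hv, c, hc, hm⟩ := h
  have hA : ρ ⁻¹' (K ∩ lowerHalfSpace (ρ ξ) t) = K ∩ lowerHalfSpace ξ t := by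
    rw [preimage_inter, hρ]
    congr 1
    ext p
    simp [lowerHalfSpace]
  have hcm := centerOfMass_preimage_isometry ρ K
  rw [hρ] at hcm
  refine ⟨t, ?_, c, hc, ?_⟩
  · rw [← hA, volume_real_preimage_isometry, hv]
  · apply ρ.injective
    rw [← hA, setIntegral_preimage_isometry_sub, hcm, hm, map_smul]

/-- The integral over the part of `K` cut off by a half-space through the origin depends
continuously on the half-space. -/
theorem tendsto_setIntegral_lowerHalfSpace {G : Type*} [NormedAddCommGroup G] [NormedSpace ℝ G]
    {F : EuclideanSpace ℝ (Fin d) → G} (hF : IntegrableOn F K) (hξ : ξ ≠ 0)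
    {η : ℕ → EuclideanSpace ℝ (Fin d)} (hη : Tendsto η atTop (𝓝 ξ)) :
    Tendsto (fun n => ∫ p in K ∩ lowerHalfSpace (η n) 0, F p) atTop
      (𝓝 (∫ p in K ∩ lowerHalfSpace ξ 0, F p)) := by
  have e : ∀ ζ : EuclideanSpace ℝ (Fin d), ∫ p in K ∩ lowerHalfSpace ζ 0, F p =
      ∫ p in K, (lowerHalfSpace ζ 0).indicator F p := fun ζ => by
    rw [setIntegral_indicator (isClosed_lowerHalfSpace ζ 0).measurableSet]
  simp only [e]
  refine tendsto_integral_of_dominated_convergence (fun p => ‖F p‖) (fun n => ?_) hF.norm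
    (fun n => ae_of_all _ fun p => norm_indicator_le_norm_self _ _) ?_
  · exact hF.aestronglyMeasurable.indicator (isClosed_lowerHalfSpace _ 0).measurableSet
  -- Off the null hyperplane the sign of `⟨p, η n⟩` is eventually that of `⟨p, ξ⟩`, so the
  -- indicators are eventually constant.
  · have := ae_restrict_of_ae (s := K) (measure_eq_zero_iff_ae_notMem.1 (volume_hyperplane hξ 0))
    filter_upwards [this] with p hp
    have hp' : inner ℝ p ξ ≠ 0 := hp
    have hlim : Tendsto (fun n => inner ℝ p (η n)) atTop (𝓝 (inner ℝ p ξ)) :=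
      tendsto_const_nhds.inner hη
    refine tendsto_const_nhds.congr' ?_
    rcases hp'.lt_or_gt with h | h
    · filter_upwards [hlim.eventually_lt_const h] with n hn
      rw [indicator_of_mem (by exact h.le), indicator_of_mem (by exact hn.le)]
    · filter_upwards [hlim.eventually_const_lt h] with n hn
      rw [indicator_of_notMem (by exact h.not_ge), indicator_of_notMem (by exact hn.not_ge)]

/-- If a set is symmetric in a hyperplane through the origin, then so is its first moment. -/
theorem inner_setIntegral_sub_eq_zero {A : Set (EuclideanSpace ℝ (Fin d))}
    {v c : EuclideanSpace ℝ (Fin d)} (hc : inner ℝ v c = 0)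
    (hA : (ℝ ∙ v)ᗮ.reflection ⁻¹' A = A) : inner ℝ v (∫ p in A, (p - c)) = 0 := by
  have h := setIntegral_preimage_isometry_sub (ℝ ∙ v)ᗮ.reflection A c
  rw [hA, Submodule.reflection_mem_subspace_eq_self
    (Submodule.mem_orthogonal_singleton_iff_inner_right.2 hc)] at h
  -- The reflection fixes the moment but sends `v` to `-v`, so the inner product equals its own
  -- negative.
  have h2 := congrArg (inner ℝ v) h
  rw [← LinearIsometryEquiv.inner_map_map (ℝ ∙ v)ᗮ.reflection,
    Submodule.reflection_reflection, Submodule.reflection_orthogonalComplement_singleton_eq_neg,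
    inner_neg_left] at h2
  linarith

end

/-! ### Symmetries of the body of revolution and reduction to a quarter meridian. -/

section
variable {m : ℕ} {a b M : ℝ} {f : ℝ → ℝ}

theorem mem_bodyOfRevolution_iff {p : EuclideanSpace ℝ (Fin (m + 2))} :
    p ∈ bodyOfRevolution 0 a b f ↔ p 0 ∈ Icc a b ∧ ‖p‖ ^ 2 - p 0 ^ 2 ≤ f (p 0) ^ 2 := by
  have h1 := Finset.add_sum_erase Finset.univ (fun j => p j ^ 2) (Finset.mem_univ (0 : Fin (m + 2)))
  rw [EuclideanSpace.real_norm_sq_eq, ← h1, add_sub_cancel_left]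
  rfl

theorem isCompact_bodyOfRevolution (hf : Continuous f) (hM : ∀ t, f t ^ 2 ≤ M ^ 2) :
    IsCompact (bodyOfRevolution (0 : Fin (m + 2)) a b f) := by
  refine Metric.isCompact_of_isClosed_isBounded ?_ ?_
  · have c1 : IsClosed {p : EuclideanSpace ℝ (Fin (m + 2)) | p 0 ∈ Icc a b} :=
      isClosed_Icc.preimage (by fun_prop)
    have c2 : IsClosed {p : EuclideanSpace ℝ (Fin (m + 2)) |
        ∑ j ∈ Finset.univ.erase 0, p j ^ 2 ≤ f (p 0) ^ 2} :=
      isClosed_le (by fun_prop) (by fun_prop)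
    exact c1.inter c2
  · refine (Metric.isBounded_closedBall (x := 0) (r := √((|a| + |b|) ^ 2 + M ^ 2))).subset ?_
    intro p hp
    rw [mem_bodyOfRevolution_iff] at hp
    rw [mem_closedBall_zero_iff]
    apply Real.le_sqrt_of_sq_le
    have h0 : |p 0| ≤ |a| + |b| := by
      rw [abs_le]
      constructor
      · linarith [hp.1.1, neg_abs_le a, abs_nonneg b]
      · linarith [hp.1.2, le_abs_self b, abs_nonneg a]
    have h1 : p 0 ^ 2 ≤ (|a| + |b|) ^ 2 := by
      rw [← sq_abs (p 0)]
      exact pow_le_pow_left₀ (abs_nonneg _) h0 2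
    linarith [hp.2, hM (p 0)]

theorem reflection_apply_of_eq_zero {d : ℕ} {v : EuclideanSpace ℝ (Fin d)} {i : Fin d}
    (hv : v i = 0) (p : EuclideanSpace ℝ (Fin d)) : (ℝ ∙ v)ᗮ.reflection p i = p i := by
  have h1 : (ℝ ∙ v)ᗮ.reflection (EuclideanSpace.single i (1 : ℝ)) = EuclideanSpace.single i 1 := by
    apply Submodule.reflection_mem_subspace_eq_self
    rw [Submodule.mem_orthogonal_singleton_iff_inner_right]
    simpa [EuclideanSpace.inner_single_right] using hv
  have h2 := (ℝ ∙ v)ᗮ.reflection.inner_map_map (EuclideanSpace.single i (1 : ℝ)) p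
  rw [h1] at h2
  simpa [EuclideanSpace.inner_single_left] using h2

theorem reflection_preimage_bodyOfRevolution {v : EuclideanSpace ℝ (Fin (m + 2))} (hv : v 0 = 0) :
    (ℝ ∙ v)ᗮ.reflection ⁻¹' bodyOfRevolution 0 a b f = bodyOfRevolution 0 a b f := by
  ext p
  rw [mem_preimage, mem_bodyOfRevolution_iff, mem_bodyOfRevolution_iff,
    reflection_apply_of_eq_zero hv, LinearIsometryEquiv.norm_map]

theorem setIntegral_sub_apply_eq_zero {d : ℕ} {A : Set (EuclideanSpace ℝ (Fin d))} {j : Fin d}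
    {c : EuclideanSpace ℝ (Fin d)} (hc : c j = 0)
    (hA : (ℝ ∙ EuclideanSpace.single j (1 : ℝ))ᗮ.reflection ⁻¹' A = A) :
    (∫ p in A, (p - c)) j = 0 := by
  have := inner_setIntegral_sub_eq_zero (c := c) (by simpa [EuclideanSpace.inner_single_left] using hc) hA
  simpa [EuclideanSpace.inner_single_left] using this

theorem centerOfMass_bodyOfRevolution_apply {j : Fin (m + 2)} (hj : j ≠ 0) :
    centerOfMass (bodyOfRevolution 0 a b f) j = 0 := by
  have := setIntegral_sub_apply_eq_zero (A := bodyOfRevolution 0 a b f) (j := j) (c := 0) rfl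
    (reflection_preimage_bodyOfRevolution (by simp [hj.symm]))
  simp only [sub_zero] at this
  rw [centerOfMass, setAverage_eq, PiLp.smul_apply, this, smul_zero]

theorem setIntegral_sub_apply {d : ℕ} {A : Set (EuclideanSpace ℝ (Fin d))} (hA : IsCompact A)
    (c : EuclideanSpace ℝ (Fin d)) (i : Fin d) :
    (∫ p in A, (p - c)) i = (∫ p in A, p i) - c i * volume.real A := by
  have h1 := (EuclideanSpace.proj (𝕜 := ℝ) i).integral_comp_comm (hA.integrableOn_sub_const c)
  simp only [PiLp.proj_apply, PiLp.sub_apply] at h1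
  have hi : IntegrableOn (fun p : EuclideanSpace ℝ (Fin d) => p i) A :=
    ContinuousOn.integrableOn_compact hA (Continuous.continuousOn (by fun_prop))
  have hci : IntegrableOn (fun _ : EuclideanSpace ℝ (Fin d) => c i) A :=
    integrableOn_const hA.measure_ne_top
  rw [← h1, integral_sub hi hci, setIntegral_const, smul_eq_mul, mul_comm]

theorem bodyOfRevolution_inter_top (hM0 : 0 ≤ M) (hM : ∀ t, f t ^ 2 ≤ M ^ 2) :
    bodyOfRevolution (0 : Fin (m + 2)) a b f ∩ {p | p 1 ≤ M} = bodyOfRevolution 0 a b f := by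
  rw [inter_eq_left]
  intro p hp
  have h1 : p 1 ^ 2 ≤ ∑ j ∈ Finset.univ.erase (0 : Fin (m + 2)), p j ^ 2 :=
    Finset.single_le_sum (f := fun j => p j ^ 2) (fun _ _ => sq_nonneg _) (by simp)
  exact (abs_le.1 (abs_le_of_sq_le_sq ((h1.trans hp.2).trans (hM _)) hM0)).2

/-- The hyperplane through the axis of a body of revolution bisects all integrals of functions of
the axial coordinate. -/
theorem setIntegral_bodyOfRevolution_eq_two_mul (hm : 0 < m) (hab : a ≤ b) (hf : Continuous f)
    (hM0 : 0 ≤ M) (hM : ∀ t, f t ^ 2 ≤ M ^ 2) {P : ℝ → ℝ} (hP : Continuous P) :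
    ∫ p in bodyOfRevolution (0 : Fin (m + 2)) a b f, P (p 0) =
      2 * (volume.real (Metric.ball (0 : EuclideanSpace ℝ (Fin m)) 1) *
        ∫ t in a..b, ∫ u in (-M)..0, P t * sliceWeight f ((m : ℝ) / 2) t u) := by
  have hq : (0 : ℝ) < (m : ℝ) / 2 := by positivity
  have h := setIntegral_bodyOfRevolution (m := m) hm hab hf (ℓ := fun _ => M) continuous_const hM0 hM
    (P := fun t _ => P t) (hP.comp continuous_fst)
  rw [bodyOfRevolution_inter_top hM0 hM] at h
  rw [h, mul_left_comm]
  refine congrArg _ ?_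
  rw [← intervalIntegral.integral_const_mul]
  refine intervalIntegral.integral_congr fun t _ => ?_
  have hc : Continuous fun u => P t * sliceWeight f ((m : ℝ) / 2) t u :=
    continuous_const.mul
      ((continuous_sliceWeight hf hq.le).comp (continuous_const.prodMk continuous_id))
  have h2 := intervalIntegral.integral_comp_neg (a := 0) (b := M)
    fun u => P t * sliceWeight f ((m : ℝ) / 2) t u
  simp only [sliceWeight_neg, neg_zero] at h2
  rw [← intervalIntegral.integral_add_adjacent_intervals (hc.intervalIntegrable (-M) 0)
    (hc.intervalIntegrable 0 M), h2, two_mul]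

theorem lowerHalfSpace_eq (s k : ℝ) :
    lowerHalfSpace (-s • EuclideanSpace.single (0 : Fin (m + 2)) (1 : ℝ) +
      EuclideanSpace.single 1 1) k = {p | p 1 ≤ s * p 0 + k} := by
  ext p
  simp only [lowerHalfSpace, mem_ofPred_eq, inner_add_right, real_inner_smul_right]
  simp only [EuclideanSpace.inner_single_right, one_mul, conj_trivial]
  constructor <;> intro h <;> linarith

/-- The volume and the first moment of the part of a body of revolution below one of the
hyperplanes `x₂ = s x₁ + h(s)`. -/
theorem volume_and_moment_of_identities (hm : 0 < m) (hab : a ≤ b) (hf : Continuous f)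
    (hM0 : 0 ≤ M) (hM : ∀ t, f t ^ 2 ≤ M ^ 2) {h : ℝ → ℝ} (hh : ContDiff ℝ ∞ h) (h0 : h 0 = 0)
    {c : ℝ} (hmoment : ∀ s : ℝ, 0 < s →
      ∫ t in a..b, sliceWeight f ((m : ℝ) / 2 + 1) t (s * t + h s) = c / √(1 + s ^ 2))
    (hcenter : ∀ s : ℝ, 0 < s →
      ∫ t in a..b, sliceWeight f ((m : ℝ) / 2) t (s * t + h s) * (t + deriv h s) = 0)
    {s : ℝ} (hs : 0 ≤ s) :
    let K := bodyOfRevolution (0 : Fin (m + 2)) a b f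
    let ξ := -s • EuclideanSpace.single (0 : Fin (m + 2)) (1 : ℝ) + EuclideanSpace.single 1 1
    volume.real (K ∩ lowerHalfSpace ξ (h s)) = volume.real K / 2 ∧
      ∫ p in K ∩ lowerHalfSpace ξ (h s), (p - centerOfMass K) =
        -(volume.real (Metric.ball (0 : EuclideanSpace ℝ (Fin m)) 1) *
          (c / (2 * ((m : ℝ) / 2 + 1))) * (1 / √(1 + s ^ 2))) • ξ := by
  intro K ξ
  have hq : (0 : ℝ) < (m : ℝ) / 2 := by positivity
  obtain ⟨hV, hX, hY⟩ := moments_of_identities hf hq hM hh hmoment hcenter hs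
  rw [h0] at hV hX
  have hK : IsCompact K := isCompact_bodyOfRevolution hf hM
  have hA : IsCompact (K ∩ lowerHalfSpace ξ (h s)) :=
    hK.inter_right (isClosed_lowerHalfSpace ξ (h s))
  have hAe : K ∩ lowerHalfSpace ξ (h s) = K ∩ {p | p 1 ≤ s * p 0 + h s} := by
    rw [lowerHalfSpace_eq]
  have hℓ : Continuous fun t => s * t + h s := by fun_prop
  have fV := setIntegral_bodyOfRevolution (m := m) hm hab hf hℓ hM0 hM (P := fun _ _ => 1)
    continuous_const
  have fX := setIntegral_bodyOfRevolution (m := m) hm hab hf hℓ hM0 hM (P := fun t _ => t)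
    continuous_fst
  have fY := setIntegral_bodyOfRevolution (m := m) hm hab hf hℓ hM0 hM (P := fun _ u => u)
    continuous_snd
  have kV := setIntegral_bodyOfRevolution_eq_two_mul (m := m) hm hab hf hM0 hM (P := fun _ => 1)
    continuous_const
  have kX := setIntegral_bodyOfRevolution_eq_two_mul (m := m) hm hab hf hM0 hM (P := fun t => t)
    continuous_id
  change ∫ p in K ∩ {p | p 1 ≤ s * p 0 + h s}, _ = _ at fV fX fY
  change ∫ p in K, _ = _ at kV kX
  rw [← hAe] at fV fX fY
  simp only [one_mul, setIntegral_const, smul_eq_mul, mul_one] at fV kV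
  rw [hV] at fV
  rw [hX] at fX
  rw [hY] at fY
  have hvol : volume.real (K ∩ lowerHalfSpace ξ (h s)) = volume.real K / 2 := by
    rw [fV, kV]
    ring
  -- The axial moment of all of `K` is its volume times the axial coordinate of its center; half of
  -- this cancels the term `X(0)`.
  have hc0 := setIntegral_sub_apply hK (centerOfMass K) 0
  rw [setIntegral_sub_centerOfMass hK, kX, PiLp.zero_apply] at hc0
  refine ⟨hvol, ?_⟩
  ext i
  refine Fin.cases ?_ (fun i => Fin.cases ?_ (fun j => ?_) i) i
  · rw [setIntegral_sub_apply hA, fX, hvol]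
    simp [ξ, -intervalIntegral.integral_const_mul]
    linear_combination -hc0 / 2
  · rw [Fin.succ_zero_eq_one, setIntegral_sub_apply hA, fY,
      centerOfMass_bodyOfRevolution_apply (by simp)]
    simp [ξ]
    ring
  -- The cut part is symmetric under `x_j ↦ -x_j` for each coordinate outside the meridian plane.
  · have n1 : j.succ.succ ≠ 1 := by
      rw [← Fin.succ_zero_eq_one]
      exact fun e => Fin.succ_ne_zero j (Fin.succ_injective _ e)
    rw [setIntegral_sub_apply_eq_zero
      (centerOfMass_bodyOfRevolution_apply (Fin.succ_ne_zero _))]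
    · simp [ξ, n1]
    · have e0 : (EuclideanSpace.single j.succ.succ (1 : ℝ) : EuclideanSpace ℝ (Fin (m + 2))) 0 = 0 := by
        simp
      have e1 : (EuclideanSpace.single j.succ.succ (1 : ℝ) : EuclideanSpace ℝ (Fin (m + 2))) 1 = 0 := by
        simp [n1.symm]
      rw [hAe, preimage_inter, reflection_preimage_bodyOfRevolution e0]
      congr 1
      ext p
      simp only [mem_preimage, mem_ofPred_eq, reflection_apply_of_eq_zero e0,
        reflection_apply_of_eq_zero e1]

/-- A body of revolution is balanced in every direction if it is balanced in the directions of a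
quarter of a meridian circle. -/
theorem cutBalanced_bodyOfRevolution_of_meridian (hf : Continuous f) (hM : ∀ t, f t ^ 2 ≤ M ^ 2)
    (hpole : CutBalanced (bodyOfRevolution (0 : Fin (m + 2)) a b f)
      (-EuclideanSpace.single 0 (1 : ℝ)))
    (hmer : ∀ s : ℝ, 0 ≤ s → CutBalanced (bodyOfRevolution (0 : Fin (m + 2)) a b f)
      (-s • EuclideanSpace.single 0 (1 : ℝ) + EuclideanSpace.single 1 1))
    {ξ : EuclideanSpace ℝ (Fin (m + 2))} (hξ : ξ ≠ 0) :
    CutBalanced (bodyOfRevolution (0 : Fin (m + 2)) a b f) ξ := by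
  set K := bodyOfRevolution (0 : Fin (m + 2)) a b f
  set e₀ : EuclideanSpace ℝ (Fin (m + 2)) := EuclideanSpace.single 0 (1 : ℝ)
  set e₁ : EuclideanSpace ℝ (Fin (m + 2)) := EuclideanSpace.single 1 (1 : ℝ)
  have hK : IsCompact K := isCompact_bodyOfRevolution hf hM
  have e₁0 : e₁ 0 = 0 := by simp [e₁]
  have key : ∀ α β : ℝ, α ≤ 0 → 0 ≤ β → α • e₀ + β • e₁ ≠ 0 → CutBalanced K (α • e₀ + β • e₁) := by
    intro α β hα hβ hne
    rcases hβ.eq_or_lt with rfl | hβ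
    · have hα' : α < 0 := lt_of_le_of_ne hα (by rintro rfl; simp at hne)
      refine CutBalanced.of_smul (inv_pos.2 (neg_pos.2 hα')) ?_
      convert hpole using 1
      rw [zero_smul, add_zero, smul_smul, inv_neg, neg_mul, inv_mul_cancel₀ hα'.ne, neg_smul,
        one_smul]
    · refine CutBalanced.of_smul (inv_pos.2 hβ) ?_
      convert hmer (-α / β) (div_nonneg (neg_nonneg.2 hα) hβ.le) using 1
      rw [smul_add, smul_smul, smul_smul, inv_mul_cancel₀ hβ.ne', one_smul, neg_div, neg_neg,
        div_eq_inv_mul]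
  have key' : ∀ α β : ℝ, 0 ≤ β → α • e₀ + β • e₁ ≠ 0 → CutBalanced K (α • e₀ + β • e₁) := by
    intro α β hβ hne
    rcases le_total α 0 with hα | hα
    · exact key α β hα hβ hne
    -- Flipping `e₁` takes a direction with `α ≥ 0` to the negative of one already treated.
    · have hρ : (ℝ ∙ e₁)ᗮ.reflection (α • e₀ + β • e₁) = -((-α) • e₀ + β • e₁) := by
        rw [map_add, map_smul, map_smul, Submodule.reflection_orthogonalComplement_singleton_eq_neg,
          Submodule.reflection_mem_subspace_eq_self]
        · module
        · rw [Submodule.mem_orthogonal_singleton_iff_inner_right]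
          simp [e₀, e₁, EuclideanSpace.inner_single_right]
      have hne' : (-α) • e₀ + β • e₁ ≠ 0 := by
        intro h
        rw [h, neg_zero, map_eq_zero_iff _ (LinearIsometryEquiv.injective _)] at hρ
        exact hne hρ
      refine CutBalanced.of_isometry (reflection_preimage_bodyOfRevolution e₁0) ?_
      rw [hρ]
      exact (key (-α) β (by linarith) hβ hne').neg hK hne'
  -- Reflecting in the hyperplane orthogonal to `w - ‖w‖ e₁` fixes the axis and moves `ξ` into the
  -- half-plane of `key'`.
  set w := ξ - ξ 0 • e₀
  have hw0 : w 0 = 0 := by simp [w, e₀]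
  have hv0 : (w - ‖w‖ • e₁) 0 = 0 := by simp [hw0, e₁0]
  have hρw : (ℝ ∙ (w - ‖w‖ • e₁))ᗮ.reflection w = ‖w‖ • e₁ :=
    Submodule.reflection_sub (by simp [norm_smul, e₁])
  have hρ : (ℝ ∙ (w - ‖w‖ • e₁))ᗮ.reflection ξ = ξ 0 • e₀ + ‖w‖ • e₁ := by
    have : ξ = ξ 0 • e₀ + w := by simp [w]
    conv_lhs => rw [this]
    rw [map_add, map_smul, hρw, Submodule.reflection_mem_subspace_eq_self]
    rw [Submodule.mem_orthogonal_singleton_iff_inner_right]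
    simpa [e₀, EuclideanSpace.inner_single_right] using hv0
  refine CutBalanced.of_isometry (reflection_preimage_bodyOfRevolution hv0) ?_
  rw [hρ]
  refine key' _ _ (norm_nonneg _) ?_
  rw [← hρ, Ne, map_eq_zero_iff _ (LinearIsometryEquiv.injective _)]
  exact hξ

end

/-! ### The axial limit and the assembly. -/

/-- A body of revolution that satisfies the integral identities along all lines
`u = s t + h(s)`, `s > 0`, is balanced in every direction. -/
theorem cutBalanced_of_identities {m : ℕ} {a b M : ℝ} {f : ℝ → ℝ} (hm : 0 < m) (hab : a ≤ b)
    (hf : Continuous f) (hM0 : 0 ≤ M) (hM : ∀ t, f t ^ 2 ≤ M ^ 2) {h : ℝ → ℝ}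
    (hh : ContDiff ℝ ∞ h) (h0 : h 0 = 0) (h1 : ∀ s, 1 ≤ s → h s = 0)
    {c : ℝ} (hc : 0 < c) (hmoment : ∀ s : ℝ, 0 < s →
      ∫ t in a..b, sliceWeight f ((m : ℝ) / 2 + 1) t (s * t + h s) = c / √(1 + s ^ 2))
    (hcenter : ∀ s : ℝ, 0 < s →
      ∫ t in a..b, sliceWeight f ((m : ℝ) / 2) t (s * t + h s) * (t + deriv h s) = 0)
    {ξ : EuclideanSpace ℝ (Fin (m + 2))} (hξ : ξ ≠ 0) :
    CutBalanced (bodyOfRevolution (0 : Fin (m + 2)) a b f) ξ := by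
  set K := bodyOfRevolution (0 : Fin (m + 2)) a b f
  set e₀ : EuclideanSpace ℝ (Fin (m + 2)) := EuclideanSpace.single 0 (1 : ℝ) with he₀
  set e₁ : EuclideanSpace ℝ (Fin (m + 2)) := EuclideanSpace.single 1 (1 : ℝ) with he₁
  have hK : IsCompact K := isCompact_bodyOfRevolution hf hM
  have hκ : 0 < volume.real (Metric.ball (0 : EuclideanSpace ℝ (Fin m)) 1) :=
    ENNReal.toReal_pos (Metric.measure_ball_pos _ _ one_pos).ne' measure_ball_lt_top.ne
  set C := volume.real (Metric.ball (0 : EuclideanSpace ℝ (Fin m)) 1) *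
    (c / (2 * ((m : ℝ) / 2 + 1)))
  have hC : 0 < C := by positivity
  have key : ∀ s : ℝ, 0 ≤ s → _ ∧ _ := fun s hs =>
    volume_and_moment_of_identities hm hab hf hM0 hM hh h0 hmoment hcenter hs
  refine cutBalanced_bodyOfRevolution_of_meridian hf hM ?_ (fun s hs => ?_) hξ
  -- The pole is approached with slopes `s = n + 1`, normals rescaled by `1 / (n + 1)`. As `s ≥ 1`,
  -- `h s = 0` and these hyperplanes all pass through the origin.
  · have hne : -e₀ ≠ 0 := by simp [he₀]
    have hε := tendsto_one_div_add_atTop_nhds_zero_nat (𝕜 := ℝ)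
    have hη : Tendsto (fun n : ℕ => -e₀ + (1 / ((n : ℝ) + 1)) • e₁) atTop (𝓝 (-e₀)) := by
      simpa using tendsto_const_nhds.add (hε.smul_const e₁)
    have hscale : ∀ n : ℕ, -((n : ℝ) + 1) • e₀ + e₁ =
        ((n : ℝ) + 1) • (-e₀ + (1 / ((n : ℝ) + 1)) • e₁) := fun n => by
      have : (n : ℝ) + 1 ≠ 0 := by positivity
      rw [smul_add, smul_smul, mul_one_div_cancel this]
      module
    have hH : ∀ n : ℕ, lowerHalfSpace (-e₀ + (1 / ((n : ℝ) + 1)) • e₁) 0 =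
        lowerHalfSpace (-((n : ℝ) + 1) • e₀ + e₁) (h ((n : ℝ) + 1)) := fun n => by
      have hn : 0 < (n : ℝ) + 1 := by positivity
      rw [h1 _ (by linarith [n.cast_nonneg (α := ℝ)]), hscale n]
      ext p
      simp only [lowerHalfSpace, mem_ofPred_eq]
      rw [real_inner_smul_right, mul_nonpos_iff_pos_imp_nonpos]
      exact ⟨fun h => ⟨fun _ => h, fun h' => hn.le⟩, fun h => h.1 hn⟩
    refine ⟨0, ?_, -C, neg_ne_zero.2 hC.ne', ?_⟩
    · have lim := tendsto_setIntegral_lowerHalfSpace (F := fun _ => (1 : ℝ))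
        (integrableOn_const hK.measure_ne_top) hne hη
      simp only [setIntegral_const, smul_eq_mul, mul_one] at lim
      refine tendsto_nhds_unique lim (tendsto_const_nhds.congr fun n => ?_)
      rw [hH]
      exact (key ((n : ℝ) + 1) (by positivity)).1.symm
    · have lim := tendsto_setIntegral_lowerHalfSpace (hK.integrableOn_sub_const (centerOfMass K))
        hne hη
      -- With `ε = 1 / s`, rescaling the normal turns the factor `C / √(1 + s²)` into `C / √(ε² +
      -- 1)`, whose limit is `C ≠ 0`.
      have hcoef : Tendsto (fun n : ℕ => -(C * (1 / √((1 / ((n : ℝ) + 1)) ^ 2 + 1)))) atTop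
          (𝓝 (-C)) := by
        have hcont : ContinuousAt (fun ε : ℝ => -(C * (1 / √(ε ^ 2 + 1)))) 0 := by
          have : ∀ ε : ℝ, √(ε ^ 2 + 1) ≠ 0 := fun ε => (Real.sqrt_pos.2 (by positivity)).ne'
          exact Continuous.continuousAt (by fun_prop (disch := exact this _))
        have hlim := hcont.tendsto
        rw [show -(C * (1 / √((0 : ℝ) ^ 2 + 1))) = -C by simp] at hlim
        exact hlim.comp hε
      refine tendsto_nhds_unique lim ((hcoef.smul hη).congr fun n => ?_)
      have hn : 0 < (n : ℝ) + 1 := by positivity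
      rw [hH]
      refine Eq.trans ?_ (key ((n : ℝ) + 1) hn.le).2.symm
      rw [← he₀, ← he₁, hscale n, smul_smul]
      congr 1
      have : √(1 + ((n : ℝ) + 1) ^ 2) = ((n : ℝ) + 1) * √((1 / ((n : ℝ) + 1)) ^ 2 + 1) := by
        rw [← Real.sqrt_sq hn.le, ← Real.sqrt_mul (by positivity), Real.sqrt_sq hn.le]
        congr 1
        field_simp
      have h2 : 0 < √((1 / ((n : ℝ) + 1)) ^ 2 + 1) := Real.sqrt_pos.2 (by positivity)
      rw [this]
      change -(C * _) = -(C * _) * _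
      clear_value C
      field_simp
  · obtain ⟨hV, hm'⟩ := key s hs
    refine ⟨h s, hV, _, ?_, hm'⟩
    have : 0 < √(1 + s ^ 2) := Real.sqrt_pos.2 (by positivity)
    exact neg_ne_zero.2 (by positivity)

theorem bodyOfRevolution_congr {d : ℕ} (i : Fin d) {a b : ℝ} {f g : ℝ → ℝ}
    (h : ∀ t ∈ Icc a b, f t = g t) : bodyOfRevolution i a b f = bodyOfRevolution i a b g := by
  ext p
  exact and_congr_right fun hp => by rw [h _ hp]

theorem proposition3p1
    (d : ℕ) (hd : 3 ≤ d)
    -- the profile of the body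
    (R₁ R₂ : ℝ) (hR₁ : 0 < R₁) (hR₂ : 0 < R₂)
    (f : ℝ → ℝ) (hf_cont : ContinuousOn f (Set.Icc (-R₁) R₂))
    (hf_conc : ConcaveOn ℝ (Set.Icc (-R₁) R₂) f)
    (hf_nonneg : ∀ t ∈ Set.Icc (-R₁) R₂, 0 ≤ f t)
    -- the perturbation function
    (τ : ℝ) (hτ : 0 < τ) (hτ' : τ < 1 / 2)
    (h : ℝ → ℝ) (hh : ContDiff ℝ ∞ h)
    (hh_supp : Function.support h ⊆ Set.Icc (1 - 2 * τ) (1 - τ))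
    -- the intersections of the lines with the profile
    (x y : ℝ → ℝ)
    (hxy : ∀ s : ℝ, 0 < s → IsChord (-R₁) R₂ f (lineL h s) (-x s) (y s))
    -- the two integral identities
    (hmoment : ∀ s : ℝ, 0 < s →
      ∫ t in (-x s)..(y s), (f t ^ 2 - lineL h s t ^ 2) ^ ((d : ℝ) / 2) =
        ballIntegral ((d : ℝ) / 2) s)
    (hcenter : ∀ s : ℝ, 0 < s →
      ∫ t in (-x s)..(y s),
        (f t ^ 2 - lineL h s t ^ 2) ^ ((d : ℝ) / 2 - 1) * deriv (fun σ => lineL h σ t) s = 0) :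
    (∃ c : ℝ, 0 < c ∧ ∀ s : ℝ, 0 < s → ballIntegral ((d : ℝ) / 2) s = c / √(1 + s ^ 2)) ∧
    FloatsInEveryOrientation (bodyOfRevolution (⟨0, by omega⟩ : Fin d) (-R₁) R₂ f)
      (MeasureTheory.volume (bodyOfRevolution (⟨0, by omega⟩ : Fin d) (-R₁) R₂ f) / 2) := by
  set c := ∫ t in (-1 : ℝ)..1, (1 - t ^ 2) ^ ((d : ℝ) / 2) with hcdef
  have hc : 0 < c := integral_one_sub_sq_rpow_pos (by positivity)
  have hball : ∀ s, ballIntegral ((d : ℝ) / 2) s = c / √(1 + s ^ 2) := ballIntegral_eq _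
  refine ⟨⟨c, hc, fun s _ => hball s⟩, fun ξ hξ => ?_⟩
  clear_value c
  obtain ⟨m, rfl⟩ : ∃ m, d = m + 2 := ⟨d - 2, by omega⟩
  have hm : 0 < m := by omega
  have hab : -R₁ ≤ R₂ := by linarith
  have hq : (0 : ℝ) < (m : ℝ) / 2 := by positivity
  have e1 : ((m + 2 : ℕ) : ℝ) / 2 = (m : ℝ) / 2 + 1 := by push_cast; ring
  have e2 : ((m + 2 : ℕ) : ℝ) / 2 - 1 = (m : ℝ) / 2 := by push_cast; ring
  simp only [hball] at hmoment
  rw [e1] at hmoment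
  rw [e2] at hcenter
  -- Extending the profile by its end values makes it continuous and bounded on `ℝ` without changing
  -- the body.
  set g : ℝ → ℝ := IccExtend hab ((Icc (-R₁) R₂).domRestrict f)
  have hg : Continuous g := (continuousOn_iff_continuous_domRestrict.1 hf_cont).Icc_extend'
  have hgf : ∀ t ∈ Icc (-R₁) R₂, f t = g t := fun t ht => (IccExtend_of_mem hab ((Icc (-R₁) R₂).domRestrict f) ht).symm
  obtain ⟨M, hM⟩ := isCompact_Icc.exists_bound_of_continuousOn hf_cont
  have hM0 : 0 ≤ M := (norm_nonneg _).trans (hM (-R₁) (left_mem_Icc.2 hab))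
  have hgM : ∀ t, g t ^ 2 ≤ M ^ 2 := fun t => by
    have := hM _ (projIcc (-R₁) R₂ hab t).2
    rw [← sq_abs]
    exact pow_le_pow_left₀ (abs_nonneg _) this 2
  have hh0 : ∀ s, s ∉ Icc (1 - 2 * τ) (1 - τ) → h s = 0 := fun s hs =>
    Function.notMem_support.1 fun hs' => hs (hh_supp hs')
  have hint : ∀ s, 0 < s → ∀ (r : ℝ), 0 < r → ∀ w : ℝ → ℝ,
      ∫ t in (-x s)..(y s), (f t ^ 2 - (s * t + h s) ^ 2) ^ r * w t =
        ∫ t in (-R₁)..R₂, sliceWeight g r t (s * t + h s) * w t := by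
    intro s hs r hr w
    have hch : IsChord (-R₁) R₂ f (fun t => s * t + h s) (-x s) (y s) := hxy s hs
    -- The first identity has a positive right-hand side, so the chord cannot run along the
    -- boundary.
    obtain ⟨t₀, ht₀, hlt⟩ := hch.exists_sq_lt_sq hf_conc hf_nonneg (r := (m : ℝ) / 2 + 1)
      (by positivity) (by
        refine ne_of_eq_of_ne (hmoment s hs) (div_pos hc (Real.sqrt_pos.2 (by positivity))).ne')
    rw [hch.integral_eq hf_conc hf_nonneg ht₀ hlt hr w]
    refine intervalIntegral.integral_congr fun t ht => ?_
    rw [uIcc_of_le hab] at ht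
    simp only [sliceWeight, hgf t ht]
  have hderiv : ∀ s t : ℝ, deriv (fun σ => lineL h σ t) s = t + deriv h s := fun s t =>
    ((hasDerivAt_mul_const t).fun_add (hh.differentiable (by simp) s).hasDerivAt).deriv
  have hξ0 : ξ ≠ 0 := by
    rintro rfl
    simp at hξ
  rw [bodyOfRevolution_congr _ hgf]
  -- `1 - 2τ > 0` gives `h 0 = 0`, and `1 - τ < 1` gives `h = 0` on `[1, ∞)`.
  refine CutBalanced.floatsInDirection (isCompact_bodyOfRevolution hg hgM) hξ0
    (cutBalanced_of_identities hm hab hg hM0 hgM hh (hh0 0 fun h => by linarith [h.1])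
      (fun s hs => hh0 s fun h => by linarith [h.2]) hc (fun s hs => ?_) (fun s hs => ?_) hξ0)
  · have := hint s hs ((m : ℝ) / 2 + 1) (by positivity) fun _ => 1
    simp only [mul_one] at this
    rw [← this]
    exact hmoment s hs
  · rw [← hint s hs _ hq, ← hcenter s hs]
    simp only [hderiv]
    rfl
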